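/- Let $H$ be a real separable infinite-dimensional Hilbert space and let $G$ be a compact Lie group acting orthogonally on $H$, i.e. through a homomorphism from $G$ to the group of linear isometric bijections of $H$. A bounded operator $T$ on $H$ is $G$-equivariant if $T(gu)=g(Tu)$ for all $g\in G$, $u\in H$. Let $\mathcal{FS}(H)$ be the set of bounded selfadjoint Fredholm operators on $H$, and for $T\in\mathcal{FS}(H)$ let $\sigma_{ess}(T)$ be the set of all $\mu\in\mathbb{R}$ such that $\mu-T$ is not Fredholm. Put $\mathcal{FS}^{+}(H)=\{T\in\mathcal{FS}(H):\sigma_{ess}(T)\subset(0,\infty)\}$, $\mathcal{FS}^{-}(H)=\{T\in\mathcal{FS}(H):\sigma_{ess}(T)\subset(-\infty,0)\}$ and $\mathcal{FS}^i(H)=\mathcal{FS}(H)\setminus(\mathcal{FS}^+(H)\cup\mathcal{FS}^-(H))$. Let $\mathcal{FS}^i(H)^G$, $GL(H)^G$ and $\mathcal{KS}(H)^G$ denote the sets of $G$-equivariant operators in $\mathcal{FS}^i(H)$, of $G$-equivariant bounded invertible operators, and of $G$-equivariant compact selfadjoint operators, respectively, each with the topology induced by the operator norm. A symmetry is an operator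 $Q=P-(I_H-P)$ with $P$ an orthogonal projection. Let $I=[0,1]$. Then for every path (continuous map) $L=\{L_\lambda\}_{\lambda\in I}$ in $\mathcal{FS}^i(H)^G$ there are a $G$-equivariant symmetry $Q\in\mathcal{FS}^i(H)^G$, a path $M=\{M_\lambda\}_{\lambda\in I}$ in $GL(H)^G$ and a path $K=\{K_\lambda\}_{\lambda\in I}$ in $\mathcal{KS}(H)^G$ such that \[M_\lambda^\ast L_\lambda M_\lambda=Q+K_\lambda\qquad\text{for all }\lambda\in I.\] -/

import Mathlib

open scoped Manifold ContDiff

section EquivariantFredholm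

variable {H : Type*} [NormedAddCommGroup H] [InnerProductSpace ℝ H] [CompleteSpace H]

/-- The essential spectrum: all real `μ` for which `μ - T` is not a Fredholm operator. -/
def essSpectrum (T : H →L[ℝ] H) : Set ℝ :=
  {μ | ¬ (μ • ContinuousLinearMap.id ℝ H - T).IsFredholm}

variable (H) in
/-- The bounded selfadjoint Fredholm operators on `H`. -/
def FS : Set (H →L[ℝ] H) := {T | IsSelfAdjoint T ∧ T.IsFredholm}

variable (H) in
/-- The selfadjoint Fredholm operators with essential spectrum in `(0, ∞)`. -/
def FSPlus : Set (H →L[ℝ] H) := {T | T ∈ FS H ∧ essSpectrum T ⊆ Set.Ioi 0}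

variable (H) in
/-- The selfadjoint Fredholm operators with essential spectrum in `(-∞, 0)`. -/
def FSMinus : Set (H →L[ℝ] H) := {T | T ∈ FS H ∧ essSpectrum T ⊆ Set.Iio 0}

variable (H) in
/-- The indefinite part of the selfadjoint Fredholm operators. -/
def FSInd : Set (H →L[ℝ] H) := FS H \ (FSPlus H ∪ FSMinus H)

/-- A symmetry is an operator `P - (1 - P)` with `P` an orthogonal projection. -/
def IsSymmetry (Q : H →L[ℝ] H) : Prop :=
  ∃ P : H →L[ℝ] H, IsStarProjection P ∧ Q = P - (ContinuousLinearMap.id ℝ H - P)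

variable {G : Type*} [Group G]

/-- `T` is equivariant for the orthogonal action `ρ`. -/
def IsEquivariant (ρ : G →* (H ≃ₗᵢ[ℝ] H)) (T : H →L[ℝ] H) : Prop :=
  ∀ (g : G) (u : H), T (ρ g u) = ρ g (T u)

/-- The equivariant operators in the indefinite part. As for the next two sets, the topology
is the one induced by the operator norm. -/
def FSIndG (ρ : G →* (H ≃ₗᵢ[ℝ] H)) : Set (H →L[ℝ] H) :=
  {T | T ∈ FSInd H ∧ IsEquivariant ρ T}

/-- The equivariant (boundedly) invertible operators. -/
def GLG (ρ : G →* (H ≃ₗᵢ[ℝ] H)) : Set (H →L[ℝ] H) :=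
  {T | IsUnit T ∧ IsEquivariant ρ T}

/-- The equivariant compact selfadjoint operators. -/
def KSG (ρ : G →* (H ≃ₗᵢ[ℝ] H)) : Set (H →L[ℝ] H) :=
  {T | IsCompactOperator T ∧ IsSelfAdjoint T ∧ IsEquivariant ρ T}

end EquivariantFredholm

/-! Two invertible selfadjoint elements `a` and `a'` that are close are congruent: `c = 1 - Y`, a
square root of `a⁻¹ a'`, satisfies `star c * a = a * c`, so `star c * a * c = a * c² = a'`. The
square root is a Banach fixed point, so it inherits every closed algebraic constraint, in particular
equivariance (membership in a commutant). Applied in the Banach algebra of operator-valued functions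
on the interval, this makes `c` continuous in `t`.

A selfadjoint Fredholm operator becomes invertible after adding the projection onto its kernel,
which is equivariant and of finite rank. Locally in `t` one such perturbation serves all `L t`, and
subdividing the interval makes the path congruent, modulo compacts, to the constant `L 0`
(`congrModCompact_const`). Finally `L 0` plus its perturbation is congruent to its sign, a symmetry,
which is indefinite because `L 0` is (`exists_symmetry_of_mem_FSIndG`). -/

/-! ### Square roots near the identity in a real Banach algebra -/

section SquareRoot

variable {R : Type*} [NormedRing R] [NormedAlgebra ℝ R] [CompleteSpace R]

/-- If `‖T‖ < 1`, then `1 - T` has a square root `1 - Y` with `‖Y‖ ≤ ‖T‖`, and `Y` lies in any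
closed set containing `0` that is stable under the iteration `Y ↦ (T + Y²) / 2`. -/
theorem exists_one_sub_mul_self_eq {T : R} (hT : ‖T‖ < 1) {S : Set R} (hS : IsClosed S)
    (h0 : (0 : R) ∈ S) (hmaps : ∀ Y ∈ S, (2⁻¹ : ℝ) • (T + Y * Y) ∈ S) :
    ∃ Y ∈ S, ‖Y‖ ≤ ‖T‖ ∧ (1 - Y) * (1 - Y) = 1 - T := by
  have hq : (0 : ℝ) ≤ ‖T‖ := norm_nonneg T
  set f : R → R := fun Y => (2⁻¹ : ℝ) • (T + Y * Y) with hf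
  -- A fixed point satisfies `2Y = T + Y²`, that is `(1 - Y)² = 1 - T`.
  have hmaps' : Set.MapsTo f (S ∩ Metric.closedBall 0 ‖T‖) (S ∩ Metric.closedBall 0 ‖T‖) := by
    rintro Y ⟨hYS, hY⟩
    refine ⟨hmaps Y hYS, ?_⟩
    rw [mem_closedBall_zero_iff] at hY ⊢
    have h1 : ‖Y * Y‖ ≤ ‖T‖ := by
      calc ‖Y * Y‖ ≤ ‖Y‖ * ‖Y‖ := norm_mul_le _ _
        _ ≤ ‖T‖ * 1 := by gcongr; linarith
        _ = ‖T‖ := mul_one _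
    calc ‖f Y‖ = 2⁻¹ * ‖T + Y * Y‖ := by rw [hf, norm_smul]; norm_num
      _ ≤ 2⁻¹ * (‖T‖ + ‖Y * Y‖) := by gcongr; exact norm_add_le _ _
      _ ≤ ‖T‖ := by linarith
  have hcontr : ContractingWith ‖T‖₊ (hmaps'.restrict f _ _) := by
    refine ⟨by exact_mod_cast hT, LipschitzWith.of_dist_le_mul ?_⟩
    rintro ⟨Y, hYS, hY⟩ ⟨Z, hZS, hZ⟩
    rw [mem_closedBall_zero_iff] at hY hZ
    simp only [Subtype.dist_eq, Set.MapsTo.val_restrict_apply, dist_eq_norm, coe_nnnorm]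
    have h1 : f Y - f Z = (2⁻¹ : ℝ) • (Y * (Y - Z) + (Y - Z) * Z) := by
      simp only [hf, ← smul_sub]
      congr 1
      noncomm_ring
    calc ‖f Y - f Z‖ = 2⁻¹ * ‖Y * (Y - Z) + (Y - Z) * Z‖ := by
          rw [h1, norm_smul]; norm_num
      _ ≤ 2⁻¹ * (‖Y‖ * ‖Y - Z‖ + ‖Y - Z‖ * ‖Z‖) := by
          gcongr
          exact (norm_add_le _ _).trans (add_le_add (norm_mul_le _ _) (norm_mul_le _ _))
      _ ≤ 2⁻¹ * (‖T‖ * ‖Y - Z‖ + ‖Y - Z‖ * ‖T‖) := by gcongr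
      _ = ‖T‖ * ‖Y - Z‖ := by ring
  obtain ⟨Y, ⟨hYS, hY⟩, hfix, -⟩ := ContractingWith.exists_fixedPoint'
    (hS.inter Metric.isClosed_closedBall).isComplete hmaps' hcontr
    ⟨h0, by simp⟩ (edist_ne_top _ _)
  refine ⟨Y, hYS, by simpa using hY, ?_⟩
  have h2 : T + Y * Y = (2 : ℝ) • Y := by
    have := congrArg (fun z => (2 : ℝ) • z) (show f Y = Y from hfix)
    simpa [hf, smul_smul] using this
  rw [two_smul] at h2
  rw [eq_sub_of_add_eq h2]
  noncomm_ring

end SquareRoot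

/-! ### Congruences in a commutant -/

section Congruence

variable {R : Type*} [NormedRing R] [NormedAlgebra ℝ R] [CompleteSpace R] [StarRing R]
  [StarModule ℝ R] [ContinuousStar R]

/-- A selfadjoint element close to the invertible selfadjoint element `a` is congruent to `a`,
by an element that commutes with everything that commutes with both. -/
theorem exists_star_mul_mul_eq_of_norm_lt {s : Set R} {a a' b : R} (ha : IsSelfAdjoint a)
    (ha' : IsSelfAdjoint a') (hab : a * b = 1) (hba : b * a = 1)
    (hbs : b ∈ s.centralizer) (has' : a' ∈ s.centralizer) (hlt : ‖1 - b * a'‖ < 1) :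
    ∃ c ∈ s.centralizer, IsUnit c ∧ star c * a * c = a' := by
  have hb : star b = b := by
    have h1 : star b * a = 1 := by
      simpa [ha.star_eq] using congrArg star hab
    exact left_inv_eq_right_inv h1 hab
  -- The second condition says that `Y` is selfadjoint for the possibly indefinite form `a`. Squares
  -- preserve it, though general products do not.
  set S : Set R := (Subalgebra.centralizer ℝ s : Set R) ∩ {Y | a * Y = star Y * a} with hS
  have hScl : IsClosed S := by
    refine IsClosed.inter ?_ (isClosed_eq (by fun_prop) (by fun_prop))
    rw [Subalgebra.coe_centralizer]
    exact Set.isClosed_centralizer s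
  have hTs : 1 - b * a' ∈ Subalgebra.centralizer ℝ s :=
    sub_mem (one_mem _) (mul_mem (S := Subalgebra ℝ R) hbs has')
  obtain ⟨Y, ⟨hYs, hY⟩, hYn, hYeq⟩ := exists_one_sub_mul_self_eq hlt hScl ⟨zero_mem _, by simp⟩ (by
    rintro Y ⟨hYs, hY⟩
    refine ⟨Subalgebra.smul_mem _ (add_mem hTs (mul_mem hYs hYs)) _, ?_⟩
    simp only [Set.mem_ofPred_eq] at hY ⊢
    have h1 : a * (Y * Y) = star Y * star Y * a := by
      rw [← mul_assoc, hY, mul_assoc, hY, mul_assoc]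
    have h2 : a * (1 - b * a') = a - a' := by
      rw [mul_sub, mul_one, ← mul_assoc, hab, one_mul]
    have h3 : (1 - a' * b) * a = a - a' := by
      rw [sub_mul, one_mul, mul_assoc, hba, mul_one]
    simp only [mul_smul_comm, star_smul, star_trivial, smul_mul_assoc, star_add, star_sub,
      star_one, star_mul, ha'.star_eq, hb, mul_add, add_mul, h1, h2, h3])
  refine ⟨1 - Y, sub_mem (one_mem (Subalgebra.centralizer ℝ s)) hYs,
    (Units.oneSub Y (hYn.trans_lt hlt)).isUnit, ?_⟩
  simp only [Set.mem_ofPred_eq] at hY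
  have h1 : star (1 - Y) * a = a * (1 - Y) := by
    rw [star_sub, star_one, sub_mul, mul_sub, hY, one_mul, mul_one]
  rw [h1, mul_assoc, hYeq, sub_sub_cancel, ← mul_assoc, hab, one_mul]

end Congruence

/-! ### Normal form of a selfadjoint invertible operator -/

section Involution

variable {R : Type*} [NormedRing R] [NormedAlgebra ℝ R] [CompleteSpace R] [StarRing R]
  [StarModule ℝ R] [ContinuousStar R]

/-- A selfadjoint element with square close to `1` is congruent to a selfadjoint involution, and
the congruence can be done in the commutant of any set of elements commuting with it. -/
theorem exists_star_mul_involution_mul_eq_of_norm_lt {s : Set R} {a : R} (ha : IsSelfAdjoint a)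
    (has : a ∈ Subalgebra.centralizer ℝ s) (hlt : ‖1 - a * a‖ < 1) :
    ∃ N ∈ s.centralizer, IsUnit N ∧ ∃ S ∈ s.centralizer, IsSelfAdjoint S ∧ S * S = 1 ∧
      star N * S * N = a := by
  set W : Subalgebra ℝ R := Subalgebra.centralizer ℝ (insert a s) with hW
  have hWcl : IsClosed ((W : Set R) ∩ {Y | star Y = Y}) := by
    refine IsClosed.inter ?_ (isClosed_eq (by fun_prop) (by fun_prop))
    rw [hW, Subalgebra.coe_centralizer]
    exact Set.isClosed_centralizer _
  have haW : a ∈ W := by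
    rw [hW, Subalgebra.mem_centralizer_iff]
    rintro g (rfl | hg)
    · rfl
    · exact has g hg
  have root : ∀ T ∈ W, star T = T → ‖T‖ < 1 →
      ∃ Y ∈ W, star Y = Y ∧ ‖Y‖ ≤ ‖T‖ ∧ (1 - Y) * (1 - Y) = 1 - T := by
    intro T hTW hT hT1
    obtain ⟨Y, ⟨hY1, hY2⟩, hY3, hY4⟩ := exists_one_sub_mul_self_eq hT1 hWcl
      ⟨zero_mem _, by simp⟩ (by
        rintro Y ⟨hY1, hY2⟩
        refine ⟨Subalgebra.smul_mem _ (add_mem hTW (mul_mem hY1 hY1)) _, ?_⟩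
        simp only [Set.mem_ofPred_eq] at hY2 ⊢
        simp [hY2, hT])
    exact ⟨Y, hY1, hY2, hY3, hY4⟩
  obtain ⟨Y, hYW, hY, hY1, hYeq⟩ := root (1 - a * a) (sub_mem (one_mem _) (mul_mem haW haW))
    (by simp [ha.star_eq]) hlt
  obtain ⟨Z, hZW, hZ, hZ1, hZeq⟩ := root Y hYW hY (hY1.trans_lt hlt)
  -- `N` is a fourth root of `a²`, hence plays the role of `|a|^(1/2)`, and `n * a * n` below is the
  -- sign of `a`.
  set N : R := 1 - Z with hN_def
  have hNW : N ∈ W := sub_mem (one_mem _) hZW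
  have hN : star N = N := by simp [hN_def, hZ]
  have hNu : IsUnit N := (Units.oneSub Z ((hZ1.trans hY1).trans_lt hlt)).isUnit
  obtain ⟨u, hu'⟩ := hNu
  set n : R := ↑u⁻¹ with hn_def
  have hNn : N * n = 1 := by rw [← hu']; exact u.mul_inv
  have hnN : n * N = 1 := by rw [← hu']; exact u.inv_mul
  have hn : star n = n := by
    have h1 : star n * N = 1 := by simpa [hN] using congrArg star hNn
    exact left_inv_eq_right_inv h1 hNn
  have hcomm : ∀ g ∈ insert a s, Commute g n := by
    intro g hg
    have : Commute g (u : R) := by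
      rw [hu']
      exact (Subalgebra.mem_centralizer_iff ℝ).1 hNW g hg
    exact this.units_inv_right
  have han : a * n = n * a := hcomm a (Set.mem_insert _ _)
  have hns : n ∈ Subalgebra.centralizer ℝ s :=
    (Subalgebra.mem_centralizer_iff ℝ).2 fun g hg => hcomm g (Set.mem_insert_of_mem _ hg)
  have hNs : N ∈ Subalgebra.centralizer ℝ s :=
    (Subalgebra.mem_centralizer_iff ℝ).2 fun g hg =>
      (Subalgebra.mem_centralizer_iff ℝ).1 hNW g (Set.mem_insert_of_mem _ hg)
  have haa : a * a = N * N * (N * N) := by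
    rw [hZeq, hYeq, sub_sub_cancel]
  refine ⟨N, hNs, ⟨u, hu'⟩, n * a * n, mul_mem (mul_mem hns has) hns, ?_, ?_, ?_⟩
  · rw [IsSelfAdjoint, star_mul, star_mul, hn, ha.star_eq, mul_assoc]
  · calc n * a * n * (n * a * n) = n * (a * n) * (n * a) * n := by simp only [mul_assoc]
      _ = n * (n * a) * (a * n) * n := by rw [han]
      _ = n * n * (a * a) * (n * n) := by simp only [mul_assoc]
      _ = n * (n * N) * N * N * (N * n) * n := by rw [haa]; simp only [mul_assoc]
      _ = 1 := by rw [hnN, hNn, mul_one, mul_one, hnN, one_mul, hNn]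
  · calc star N * (n * a * n) * N = (N * n) * a * (n * N) := by rw [hN]; simp only [mul_assoc]
      _ = a := by rw [hNn, hnN, one_mul, mul_one]

end Involution

section NormalForm

variable {H : Type*} [NormedAddCommGroup H] [InnerProductSpace ℝ H] [CompleteSpace H]

/-- A rescaling of a selfadjoint invertible operator has its square at distance less than one
from the identity. -/
theorem exists_norm_one_sub_smul_sq_lt [Nontrivial H] {A : H →L[ℝ] H} (hA : IsSelfAdjoint A)
    (hu : IsUnit A) :
    ∃ r : ℝ, 0 < r ∧ ‖1 - (r • A) * (r • A)‖ < 1 := by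
  obtain ⟨B, hAB, hBA⟩ : ∃ B, A * B = 1 ∧ B * A = 1 :=
    ⟨↑hu.unit⁻¹, hu.mul_val_inv, hu.val_inv_mul⟩
  have hApos : 0 < ‖A‖ := norm_pos_iff.2 hu.ne_zero
  have hBpos : 0 < ‖B‖ := norm_pos_iff.2 (by rintro rfl; simp at hAB)
  refine ⟨‖A‖⁻¹, inv_pos.2 hApos, ?_⟩
  set a : H →L[ℝ] H := ‖A‖⁻¹ • A with ha_def
  have ha : ∀ x y, inner ℝ (a x) y = inner ℝ x (a y) :=
    (show IsSelfAdjoint a from .smul (.all _) hA).isSymmetric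
  have ha1 : ‖a‖ ≤ 1 := by
    rw [ha_def, norm_smul, norm_inv, norm_norm, inv_mul_cancel₀ hApos.ne']
  set c : ℝ := (‖A‖ * ‖B‖)⁻¹ with hc_def
  have hc : 0 < c := by positivity
  have hac : ∀ x, c * ‖x‖ ≤ ‖a x‖ := by
    intro x
    have h1 : ‖x‖ ≤ ‖B‖ * ‖A x‖ := by
      calc ‖x‖ = ‖B (A x)‖ := by rw [← mul_apply_eq_comp, hBA]; rfl
        _ ≤ _ := B.le_opNorm _
    have h2 : ‖a x‖ = ‖A‖⁻¹ * ‖A x‖ := by simp [ha_def, norm_smul]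
    rw [h2, hc_def, mul_inv, mul_assoc]
    gcongr
    rwa [inv_mul_le_iff₀ hBpos]
  have hc1 : c ≤ 1 := by
    obtain ⟨x, hx⟩ := exists_ne (0 : H)
    have hx' : 0 < ‖x‖ := norm_pos_iff.2 hx
    have := (hac x).trans (a.le_of_opNorm_le ha1 x)
    exact le_of_mul_le_mul_right this hx'
  -- Expanding gives `‖x‖² - 2‖a x‖² + ‖a (a x)‖² ≤ ‖x‖² - ‖a x‖²`, since `‖a‖ ≤ 1`.
  have key : ∀ x, ‖(1 - a * a) x‖ ^ 2 ≤ (1 - c ^ 2) * ‖x‖ ^ 2 := by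
    intro x
    have h1 : (1 - a * a) x = x - a (a x) := rfl
    have h2 : inner ℝ x (a (a x)) = ‖a x‖ ^ 2 := by
      rw [← ha, real_inner_self_eq_norm_sq]
    have h3 : ‖a (a x)‖ ≤ ‖a x‖ := by simpa using a.le_of_opNorm_le ha1 (a x)
    have h4 : ‖a (a x)‖ ^ 2 ≤ ‖a x‖ ^ 2 := by gcongr
    have h5 : (c * ‖x‖) ^ 2 ≤ ‖a x‖ ^ 2 := by
      have := hac x
      gcongr
    rw [h1, norm_sub_sq_real, h2]
    nlinarith
  have hbound : ‖1 - a * a‖ ≤ Real.sqrt (1 - c ^ 2) := by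
    refine ContinuousLinearMap.opNorm_le_bound _ (Real.sqrt_nonneg _) fun x => ?_
    refine le_of_sq_le_sq ?_ (by positivity)
    rw [mul_pow, Real.sq_sqrt (by nlinarith)]
    exact key x
  refine hbound.trans_lt ?_
  rw [Real.sqrt_lt' one_pos]
  nlinarith [pow_pos hc 2]

/-- Every selfadjoint invertible operator is congruent to a selfadjoint involution, and the
congruence can be done in the commutant of any set of operators commuting with it. -/
theorem exists_star_mul_involution_mul_eq {s : Set (H →L[ℝ] H)} {A : H →L[ℝ] H}
    (hA : IsSelfAdjoint A) (hu : IsUnit A) (hAs : A ∈ s.centralizer) :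
    ∃ N ∈ s.centralizer, IsUnit N ∧ ∃ S ∈ s.centralizer, IsSelfAdjoint S ∧ S * S = 1 ∧
      star N * S * N = A := by
  rcases subsingleton_or_nontrivial H with hsub | hnt
  · exact ⟨A, hAs, hu, A, hAs, hA, Subsingleton.elim _ _, Subsingleton.elim _ _⟩
  obtain ⟨r, hr, hlt⟩ := exists_norm_one_sub_smul_sq_lt hA hu
  have has : r • A ∈ Subalgebra.centralizer ℝ s := Subalgebra.smul_mem _ hAs r
  obtain ⟨N, hNs, hNu, S, hSs, hS, hSS, hN⟩ :=
    exists_star_mul_involution_mul_eq_of_norm_lt (.smul (.all r) hA) has hlt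
  have hsq : √r⁻¹ * √r⁻¹ = r⁻¹ := Real.mul_self_sqrt (inv_pos.2 hr).le
  have hsq0 : √r⁻¹ ≠ 0 := (Real.sqrt_pos.2 (inv_pos.2 hr)).ne'
  refine ⟨√r⁻¹ • N, Subalgebra.smul_mem (Subalgebra.centralizer ℝ s) hNs _,
    hNu.smul (Units.mk0 _ hsq0), S, hSs, hS, hSS, ?_⟩
  rw [star_smul, star_trivial, smul_mul_assoc, smul_mul_assoc, mul_smul_comm, smul_smul, hsq, hN,
    smul_smul, inv_mul_cancel₀ hr.ne', one_smul]

end NormalForm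

/-! ### Selfadjoint Fredholm operators -/

section Fredholm

open scoped LinearMap.FiniteRangeSetoid in
/-- A finite rank perturbation of an invertible operator is Fredholm. -/
theorem IsUnit.isFredholm_add {H : Type*} [NormedAddCommGroup H] [NormedSpace ℝ H]
    {U F : H →L[ℝ] H} (hU : IsUnit U)
    (hF : (F : H →ₗ[ℝ] H).HasFiniteRange) : (U + F).IsFredholm := by
  obtain ⟨V, hUV, hVU⟩ : ∃ V, U * V = 1 ∧ V * U = 1 :=
    ⟨↑hU.unit⁻¹, hU.mul_val_inv, hU.val_inv_mul⟩
  refine .of_isQuasiInverse (v := V) ⟨?_, ?_⟩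
  · refine LinearMap.FiniteRangeSetoid.equiv_iff_hasFiniteRange.2 ?_
    have h : (V : H →ₗ[ℝ] H) ∘ₗ ((U + F : H →L[ℝ] H) : H →ₗ[ℝ] H) - LinearMap.id =
        (V : H →ₗ[ℝ] H) ∘ₗ (F : H →ₗ[ℝ] H) := by
      ext x
      have : V (U x) = x := (DFunLike.congr_fun hVU x)
      simp [this]
    rw [h]
    exact hF.comp_left _
  · refine LinearMap.FiniteRangeSetoid.equiv_iff_hasFiniteRange.2 ?_
    have h : ((U + F : H →L[ℝ] H) : H →ₗ[ℝ] H) ∘ₗ (V : H →ₗ[ℝ] H) - LinearMap.id =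
        (F : H →ₗ[ℝ] H) ∘ₗ (V : H →ₗ[ℝ] H) := by
      ext x
      have : U (V x) = x := (DFunLike.congr_fun hUV x)
      simp [this]
    rw [h]
    exact hF.comp_right _

variable {H : Type*} [NormedAddCommGroup H] [InnerProductSpace ℝ H] [CompleteSpace H]

/-- A selfadjoint Fredholm operator becomes invertible after adding the orthogonal projection onto
its kernel. -/
theorem isUnit_add_starProjection_ker {L : H →L[ℝ] H} (hL : IsSelfAdjoint L) (hF : L.IsFredholm)
    [L.ker.HasOrthogonalProjection] : IsUnit (L + L.ker.starProjection) := by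
  rw [ContinuousLinearMap.isUnit_iff_bijective]
  have hsymm : ∀ x y, inner ℝ (L x) y = inner ℝ x (L y) := hL.isSymmetric
  -- Closedness of the range, from Fredholmness, removes the closure in `ker Lᗮ = closure (range
  -- L*)`.
  have hker : L.kerᗮ = L.range := by
    rw [L.orthogonal_ker, ContinuousLinearMap.isSelfAdjoint_iff'.1 hL,
      hF.isClosed_range.submodule_topologicalClosure_eq]
  have hLP : ∀ x, L (L.ker.starProjection x) = 0 := fun x =>
    LinearMap.mem_ker.1 (L.ker.starProjection_apply_mem x)
  constructor
  · rw [injective_iff_map_eq_zero]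
    intro x hx
    have hx' : L x + L.ker.starProjection x = 0 := hx
    have h1 : inner ℝ (L x) (L.ker.starProjection x) = 0 := by
      rw [hsymm, hLP, inner_zero_right]
    have h2 : L x = 0 := by
      have h3 : inner ℝ (L x) (L x + L.ker.starProjection x) = 0 := by rw [hx', inner_zero_right]
      rw [inner_add_right, h1, add_zero] at h3
      exact inner_self_eq_zero.1 h3
    rw [h2, zero_add, Submodule.starProjection_eq_self_iff.2 (LinearMap.mem_ker.2 h2)] at hx'
    exact hx'
  · intro y
    have h1 : y - L.ker.starProjection y ∈ L.range := by
      rw [← hker]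
      exact Submodule.sub_starProjection_mem_orthogonal y
    obtain ⟨z, hz⟩ := h1
    refine ⟨z - L.ker.starProjection z + L.ker.starProjection y, ?_⟩
    have h2 : L.ker.starProjection (L.ker.starProjection y) = L.ker.starProjection y :=
      Submodule.starProjection_eq_self_iff.2 (Submodule.starProjection_apply_mem _ y)
    have h3 : L.ker.starProjection (L.ker.starProjection z) = L.ker.starProjection z :=
      Submodule.starProjection_eq_self_iff.2 (Submodule.starProjection_apply_mem _ z)
    have hz' : L z = y - L.ker.starProjection y := hz
    simp [hLP, h2, h3, hz']

/-- The quadratic form is `r‖x‖² + ‖N x‖²`, which is coercive because `N` has a bounded inverse. -/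
theorem isUnit_smul_add_star_mul_self {N : H →L[ℝ] H} (hN : IsUnit N) {r : ℝ} (hr : 0 ≤ r) :
    IsUnit (r • (1 : H →L[ℝ] H) + star N * N) := by
  obtain ⟨B, hBN⟩ : ∃ B, B * N = 1 := ⟨↑hN.unit⁻¹, hN.val_inv_mul⟩
  have hb : 0 < 1 + ‖B‖ := by positivity
  have hc : 0 < ((1 + ‖B‖)⁻¹) ^ 2 := by positivity
  refine ContinuousLinearMap.isUnit_of_forall_le_norm_inner_map _
    (c := Real.toNNReal (((1 + ‖B‖)⁻¹) ^ 2)) (Real.toNNReal_pos.2 hc) fun x => ?_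
  have h1 : inner ℝ ((r • (1 : H →L[ℝ] H) + star N * N) x) x = r * ‖x‖ ^ 2 + ‖N x‖ ^ 2 := by
    simp [inner_add_left, inner_smul_left, ContinuousLinearMap.star_eq_adjoint,
      ContinuousLinearMap.adjoint_inner_left]
  have h2 : (1 + ‖B‖)⁻¹ * ‖x‖ ≤ ‖N x‖ := by
    rw [inv_mul_le_iff₀ hb]
    calc ‖x‖ = ‖B (N x)‖ := by rw [← mul_apply_eq_comp, hBN]; rfl
      _ ≤ ‖B‖ * ‖N x‖ := B.le_opNorm _
      _ ≤ (1 + ‖B‖) * ‖N x‖ := by gcongr; linarith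
  have h3 : ((1 + ‖B‖)⁻¹ * ‖x‖) ^ 2 ≤ ‖N x‖ ^ 2 := by gcongr
  rw [h1, Real.norm_of_nonneg (by positivity)]
  rw [Real.coe_toNNReal _ hc.le]
  have : 0 ≤ r * ‖x‖ ^ 2 := by positivity
  nlinarith

/-- If an involution `S` that is congruent to `L` up to finite rank misses the essential spectral
value `-c` with `c = ±1`, then the essential spectrum of `L` lies strictly on the side of `c`. -/
theorem notMem_essSpectrum_of_congruent_involution {L F N S : H →L[ℝ] H} (hN : IsUnit N)
    (hF : (F : H →ₗ[ℝ] H).HasFiniteRange) (hS : S * S = 1) (hL : L = star N * S * N + F)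
    {c : ℝ} (hc : c * c = 1) (hcS : -c ∉ essSpectrum S) {μ : ℝ} (hμ : c * μ ≤ 0) :
    μ ∉ essSpectrum L := by
  have hfred : ((-c) • ContinuousLinearMap.id ℝ H - S).IsFredholm := not_not.1 hcS
  -- Since `(S + c)(S - c) = 0`, the range of `S - c` lies in the finite-dimensional kernel of `-c -
  -- S`. Thus `L` is `c N*N` up to finite rank.
  have hE : ((S - c • 1 : H →L[ℝ] H) : H →ₗ[ℝ] H).HasFiniteRange := by
    have hfin := hfred.finite_ker
    rw [LinearMap.HasFiniteRange, Submodule.fg_iff_finiteDimensional]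
    refine Submodule.finiteDimensional_of_le (S₂ := ((-c) • ContinuousLinearMap.id ℝ H - S).ker) ?_
    rintro _ ⟨x, rfl⟩
    have hSx : S (S x) = x := (DFunLike.congr_fun hS x)
    simp only [LinearMap.mem_ker, ContinuousLinearMap.coe_coe]
    change (-c) • (S x - c • x) - S (S x - c • x) = 0
    rw [map_sub, map_smul, hSx, smul_sub, smul_smul, neg_mul, hc, neg_smul, neg_smul, one_smul]
    abel
  -- As `c² = 1`, this is `-c (-cμ + N*N)` with `-cμ ≥ 0`.
  have hU : IsUnit (μ • 1 - c • (star N * N)) := by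
    have h1 := (isUnit_smul_add_star_mul_self hN (r := -(c * μ)) (by linarith)).smul
      (Units.mk0 (-c) (by rintro h; simp_all))
    convert h1 using 1
    rw [Units.smul_def, Units.val_mk0, smul_add, smul_smul, neg_smul, neg_mul_neg, ← mul_assoc, hc,
      one_mul, sub_eq_add_neg]
  rw [essSpectrum, Set.mem_ofPred_eq, not_not]
  have h2 : μ • ContinuousLinearMap.id ℝ H - L =
      (μ • 1 - c • (star N * N)) + -(star N * (S - c • 1) * N + F) := by
    have h3 : star N * (S - c • 1) * N = star N * S * N - c • (star N * N) := by
      rw [mul_sub, sub_mul, mul_smul_comm, mul_one, smul_mul_assoc]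
    rw [hL, h3, ContinuousLinearMap.one_def]
    abel
  rw [h2]
  refine hU.isFredholm_add ?_
  exact (((hE.comp_left (star N : H →L[ℝ] H).toLinearMap).comp_right N.toLinearMap).add hF).neg

end Fredholm

/-! ### Equivariant operators -/

section Equivariant

variable {H : Type*} [NormedAddCommGroup H] [InnerProductSpace ℝ H]
  {G : Type*} [Group G] {ρ : G →* (H ≃ₗᵢ[ℝ] H)}

/-- The bounded operators by which the group acts. -/
def actionOperators (ρ : G →* (H ≃ₗᵢ[ℝ] H)) : Set (H →L[ℝ] H) :=
  Set.range fun g => ((ρ g).toContinuousLinearEquiv : H →L[ℝ] H)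

theorem isEquivariant_iff_mem_centralizer {T : H →L[ℝ] H} :
    IsEquivariant ρ T ↔ T ∈ (actionOperators ρ).centralizer := by
  simp only [IsEquivariant, actionOperators, Set.mem_centralizer_iff, Set.forall_mem_range]
  refine forall_congr' fun g => ⟨fun h => ?_, fun h u => ?_⟩
  · ext u
    exact (h u).symm
  · exact (DFunLike.congr_fun h u).symm

theorem IsEquivariant.mul {S T : H →L[ℝ] H} (hS : IsEquivariant ρ S) (hT : IsEquivariant ρ T) :
    IsEquivariant ρ (S * T) := fun g u => by
  rw [mul_apply_eq_comp, mul_apply_eq_comp, hT, hS]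

theorem IsEquivariant.add {S T : H →L[ℝ] H} (hS : IsEquivariant ρ S) (hT : IsEquivariant ρ T) :
    IsEquivariant ρ (S + T) := fun g u => by
  simp [hS g u, hT g u]

theorem IsEquivariant.sub {S T : H →L[ℝ] H} (hS : IsEquivariant ρ S) (hT : IsEquivariant ρ T) :
    IsEquivariant ρ (S - T) := fun g u => by
  simp [hS g u, hT g u]

theorem one_mem_GLG : (1 : H →L[ℝ] H) ∈ GLG ρ := ⟨isUnit_one, fun _ _ => rfl⟩

theorem IsEquivariant.of_mul_eq_one {S T : H →L[ℝ] H} (hT : IsEquivariant ρ T) (hST : S * T = 1)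
    (hTS : T * S = 1) : IsEquivariant ρ S := by
  rw [isEquivariant_iff_mem_centralizer] at *
  exact fun g hg => Commute.units_inv_right (u := ⟨T, S, hTS, hST⟩) (hT g hg)

theorem mul_mem_GLG {S T : H →L[ℝ] H} (hS : S ∈ GLG ρ) (hT : T ∈ GLG ρ) : S * T ∈ GLG ρ :=
  ⟨hS.1.mul hT.1, hS.2.mul hT.2⟩

theorem exists_inv_mem_GLG {T : H →L[ℝ] H} (hT : T ∈ GLG ρ) :
    ∃ S ∈ GLG ρ, S * T = 1 ∧ T * S = 1 := by
  obtain ⟨⟨u, rfl⟩, h⟩ := hT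
  exact ⟨↑u⁻¹, ⟨u⁻¹.isUnit, h.of_mul_eq_one u.inv_mul u.mul_inv⟩, u.inv_mul, u.mul_inv⟩

/-- The kernel is invariant and the action is isometric, so it preserves the orthogonal
decomposition. -/
theorem IsEquivariant.starProjection_ker {T : H →L[ℝ] H} (hT : IsEquivariant ρ T)
    [T.ker.HasOrthogonalProjection] : IsEquivariant ρ T.ker.starProjection := fun g u => by
  refine (Submodule.eq_starProjection_of_mem_of_inner_eq_zero (K := T.ker) ?_ fun w hw => ?_)
  · have h : T (T.ker.starProjection u) = 0 :=
      LinearMap.mem_ker.1 (T.ker.starProjection_apply_mem u)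
    exact LinearMap.mem_ker.2 (by simp [hT g, h])
  · have hg : ρ g (ρ g⁻¹ w) = w := by
      rw [map_inv]; exact (ρ g).apply_symm_apply _
    have hw' : ρ g⁻¹ w ∈ T.ker := by
      have : T w = 0 := LinearMap.mem_ker.1 hw
      exact LinearMap.mem_ker.2 (by
        rw [ContinuousLinearMap.coe_coe, hT, this, map_zero])
    rw [← hg, ← map_sub, (ρ g).inner_map_map]
    exact Submodule.starProjection_inner_eq_zero u _ hw'

variable [CompleteSpace H]

theorem IsEquivariant.star {T : H →L[ℝ] H} (hT : IsEquivariant ρ T) :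
    IsEquivariant ρ (star T) := fun g u => by
  have hinv : ∀ w v : H, inner ℝ (ρ g w) v = inner ℝ w (ρ g⁻¹ v) := fun w v => by
    have : ρ g (ρ g⁻¹ v) = v := by
      rw [map_inv]; exact (ρ g).apply_symm_apply _
    conv_lhs => rw [← this]
    exact (ρ g).inner_map_map _ _
  refine ext_inner_right ℝ fun v => ?_
  rw [hinv, ContinuousLinearMap.star_eq_adjoint, ContinuousLinearMap.adjoint_inner_left,
    ContinuousLinearMap.adjoint_inner_left, hinv, hT]

theorem add_mem_KSG {S T : H →L[ℝ] H} (hS : S ∈ KSG ρ) (hT : T ∈ KSG ρ) : S + T ∈ KSG ρ :=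
  ⟨hS.1.add hT.1, hS.2.1.add hT.2.1, hS.2.2.add hT.2.2⟩

theorem sub_mem_KSG {S T : H →L[ℝ] H} (hS : S ∈ KSG ρ) (hT : T ∈ KSG ρ) : S - T ∈ KSG ρ :=
  ⟨hS.1.sub hT.1, hS.2.1.sub hT.2.1, hS.2.2.sub hT.2.2⟩

theorem star_mul_mul_mem_KSG {M T : H →L[ℝ] H} (hT : T ∈ KSG ρ) (hM : IsEquivariant ρ M) :
    star M * T * M ∈ KSG ρ :=
  ⟨(hT.1.clm_comp (star M)).comp_clm M, hT.2.1.conjugate' M, (hM.star.mul hT.2.2).mul hM⟩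

theorem zero_mem_KSG : (0 : H →L[ℝ] H) ∈ KSG ρ :=
  ⟨isCompactOperator_zero, .zero _, fun g u => by simp⟩

/-- An equivariant selfadjoint Fredholm operator has an equivariant selfadjoint finite rank
perturbation that is invertible. -/
theorem exists_finiteRange_isUnit_add {L : H →L[ℝ] H} (hL : L ∈ FS H) (hLρ : IsEquivariant ρ L) :
    ∃ P ∈ KSG ρ, (P : H →ₗ[ℝ] H).HasFiniteRange ∧ IsUnit (L + P) := by
  have hfin := hL.2.finite_ker
  have hfr : (L.ker.starProjection : H →ₗ[ℝ] H).HasFiniteRange :=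
    LinearMap.HasFiniteRange.comp_right LinearMap.HasFiniteRange.of_finite_dom
      (L.ker.orthogonalProjectionOnto : H →ₗ[ℝ] L.ker)
  refine ⟨L.ker.starProjection, ⟨?_, isSelfAdjoint_starProjection _, hLρ.starProjection_ker⟩,
    hfr, isUnit_add_starProjection_ker hL.1 hL.2⟩
  exact (isCompactOperator_of_locallyCompactSpace_dom
    L.ker.orthogonalProjectionOnto).clm_comp L.ker.subtypeL

end Equivariant

/-! ### Congruence of paths modulo compact operators -/

section Paths

variable {H : Type*} [NormedAddCommGroup H] [InnerProductSpace ℝ H] [CompleteSpace H]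
  {G : Type*} [Group G] {ρ : G →* (H ≃ₗᵢ[ℝ] H)}

/-- Two paths of operators are congruent modulo paths of equivariant compact selfadjoint
operators, by a path of equivariant invertible operators. -/
def CongrModCompact (ρ : G →* (H ≃ₗᵢ[ℝ] H)) (L L' : C(unitInterval, H →L[ℝ] H)) : Prop :=
  ∃ M K : C(unitInterval, H →L[ℝ] H), (∀ t, M t ∈ GLG ρ) ∧ (∀ t, K t ∈ KSG ρ) ∧
    ∀ t, star (M t) * L t * M t = L' t + K t

theorem CongrModCompact.refl (L : C(unitInterval, H →L[ℝ] H)) : CongrModCompact ρ L L :=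
  ⟨1, 0, fun _ => one_mem_GLG, fun _ => zero_mem_KSG, fun t => by simp⟩

theorem CongrModCompact.trans {L L' L'' : C(unitInterval, H →L[ℝ] H)}
    (h : CongrModCompact ρ L L') (h' : CongrModCompact ρ L' L'') : CongrModCompact ρ L L'' := by
  obtain ⟨M, K, hM, hK, h⟩ := h
  obtain ⟨M', K', hM', hK', h'⟩ := h'
  refine ⟨M * M', K' + star M' * K * M', fun t => mul_mem_GLG (hM t) (hM' t),
    fun t => add_mem_KSG (hK' t) (star_mul_mul_mem_KSG (hK t) (hM' t).2), fun t => ?_⟩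
  calc star ((M * M') t) * L t * (M * M') t = star (M' t) * (star (M t) * L t * M t) * M' t := by
        rw [ContinuousMap.mul_apply, star_mul]; simp only [mul_assoc]
    _ = L'' t + K' t + star (M' t) * K t * M' t := by rw [h, mul_add, add_mul, h']
    _ = L'' t + (K' + star M' * K * M') t := add_assoc _ _ _

/-- The path that follows `L` up to time `x` and stays at `L x` from then on. -/
noncomputable def stoppedPath (L : C(unitInterval, H →L[ℝ] H)) (x : unitInterval) :
    C(unitInterval, H →L[ℝ] H) :=
  ⟨fun t => L (min t x), by fun_prop⟩

/-- A path can be stopped earlier, modulo congruence and compact operators, as long as a compact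
perturbation of it stays close to a fixed invertible operator. -/
theorem congrModCompact_stoppedPath {L : C(unitInterval, H →L[ℝ] H)}
    (hL : ∀ t, IsSelfAdjoint (L t)) (hLρ : ∀ t, IsEquivariant ρ (L t)) {A B P : H →L[ℝ] H}
    (hA : IsSelfAdjoint A) (hAρ : IsEquivariant ρ A) (hAB : A * B = 1) (hBA : B * A = 1)
    (hP : P ∈ KSG ρ) {x y : unitInterval} (hxy : x ≤ y)
    (hlt : ∀ t ∈ Set.Icc x y, ‖1 - B * (L t + P)‖ < 1) :
    CongrModCompact ρ (stoppedPath L y) (stoppedPath L x) := by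
  set c : C(unitInterval, unitInterval) := ⟨fun t => max x (min t y), by fun_prop⟩ with hc_def
  have hcx : ∀ t ≤ x, c t = x := fun t ht => max_eq_left (min_le_left _ _ |>.trans ht)
  have hcy : ∀ t, x ≤ t → c t = min t y := fun t ht => max_eq_right (le_min ht hxy)
  have hc : ∀ t, c t ∈ Set.Icc x y := fun t => ⟨le_max_left _ _, max_le hxy (min_le_right _ _)⟩
  have hcc : ∀ t, c (c t) = c t := fun t => by
    rw [hcy _ (hc t).1, min_eq_left (hc t).2]
  set k : (H →L[ℝ] H) → C(unitInterval, H →L[ℝ] H) := ContinuousMap.const _ with hk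
  have hB : IsEquivariant ρ B := hAρ.of_mul_eq_one hBA hAB
  have hcent : ∀ F : C(unitInterval, H →L[ℝ] H),
      F ∈ (k '' actionOperators ρ).centralizer ↔ ∀ t, IsEquivariant ρ (F t) := by
    intro F
    simp only [isEquivariant_iff_mem_centralizer, Set.mem_centralizer_iff, Set.forall_mem_image,
      ContinuousMap.ext_iff]
    exact ⟨fun h t m hm => h hm t, fun h m hm t => h t m hm⟩
  obtain ⟨C, hCρ, hCu, hC⟩ := exists_star_mul_mul_eq_of_norm_lt
    (s := k '' actionOperators ρ) (a := k A) (b := k B) (a' := L.comp c + k P)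
    (ContinuousMap.ext fun t => hA.star_eq)
    (ContinuousMap.ext fun t => ((hL (c t)).add hP.2.1).star_eq)
    (ContinuousMap.ext fun t => hAB) (ContinuousMap.ext fun t => hBA)
    ((hcent _).2 fun t => hB) ((hcent _).2 fun t => (hLρ (c t)).add hP.2.2)
    ((ContinuousMap.norm_lt_iff _ one_pos).2 fun t => hlt (c t) (hc t))
  rw [hcent] at hCρ
  obtain ⟨D, hCD, hDC⟩ : ∃ D, C * D = 1 ∧ D * C = 1 :=
    ⟨↑hCu.unit⁻¹, hCu.mul_val_inv, hCu.val_inv_mul⟩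
  have hCD' : ∀ t, C t * D t = 1 := fun t => (DFunLike.congr_fun hCD t)
  have hDC' : ∀ t, D t * C t = 1 := fun t => (DFunLike.congr_fun hDC t)
  have hC' : ∀ t, star (C t) * A * C t = L (c t) + P := fun t => (DFunLike.congr_fun hC t)
  -- `C (c t)⁻¹ C x` carries `L (c t) + P` to `L x + P`. Precomposing with the clamp `c` forces `M t
  -- = 1` for `t ≤ x`, where the two stopped paths already agree.
  set M : C(unitInterval, H →L[ℝ] H) := D.comp c * k (C x) with hM_def
  have hM : ∀ t, M t ∈ GLG ρ := fun t =>
    ⟨IsUnit.mul ⟨⟨_, _, hDC' (c t), hCD' (c t)⟩, rfl⟩ ⟨⟨_, _, hCD' x, hDC' x⟩, rfl⟩,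
      ((hCρ (c t)).of_mul_eq_one (hDC' _) (hCD' _)).mul (hCρ x)⟩
  have hML : ∀ t, star (M t) * L (c t) * M t = L x + (P - star (M t) * P * M t) := by
    intro t
    have h1 : C (c t) * M t = C x := by
      change C (c t) * (D (c t) * C x) = C x
      rw [← mul_assoc, hCD', one_mul]
    have h2 : star (M t) * (L (c t) + P) * M t = L x + P := by
      calc star (M t) * (L (c t) + P) * M t = star (C (c t) * M t) * A * (C (c t) * M t) := by
            rw [star_mul, ← hcc t, ← hC', hcc t]; simp only [mul_assoc]
        _ = L x + P := by rw [h1, hC', hcx x le_rfl]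
    rw [mul_add, add_mul] at h2
    rw [eq_sub_of_add_eq h2, add_sub_assoc]
  refine ⟨M, k P - star M * k P * M, hM,
    fun t => sub_mem_KSG hP (star_mul_mul_mem_KSG hP (hM t).2), fun t => ?_⟩
  change star (M t) * L (min t y) * M t = L (min t x) + (P - star (M t) * P * M t)
  rcases le_total t x with htx | htx
  · have h1 : M t = 1 := by
      change D (c t) * C x = 1
      rw [hcx t htx, hDC']
    rw [h1, min_eq_left htx, min_eq_left (htx.trans hxy)]
    simp
  · rw [min_eq_right htx, ← hML, hcy t htx]

/-- A path of equivariant selfadjoint Fredholm operators is congruent to a constant path, modulo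
compact operators. -/
theorem congrModCompact_const {L : C(unitInterval, H →L[ℝ] H)} (hL : ∀ t, L t ∈ FS H)
    (hLρ : ∀ t, IsEquivariant ρ (L t)) :
    CongrModCompact ρ L (ContinuousMap.const _ (L 0)) := by
  -- `P` need not depend continuously on its index: each subinterval uses a single `P s`, and its
  -- contribution is absorbed into the compact term.
  choose P hP hPfin hPu using fun t => exists_finiteRange_isUnit_add (hL t) (hLρ t)
  choose B hB hBA hAB using fun t =>
    exists_inv_mem_GLG (ρ := ρ) ⟨hPu t, (hLρ t).add (hP t).2.2⟩
  obtain ⟨x, hx0, hxmono, ⟨n, hn⟩, hx⟩ :=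
    exists_monotone_Icc_subset_open_cover_unitInterval
      (c := fun s => {t | ‖1 - B s * (L t + P s)‖ < 1})
      (fun s => isOpen_lt (by fun_prop) continuous_const)
      (fun s _ => Set.mem_iUnion.2 ⟨s, by simp [hBA s]⟩)
  have key : ∀ m, CongrModCompact ρ (stoppedPath L (x m)) (ContinuousMap.const _ (L 0)) := by
    intro m
    induction m with
    | zero =>
      have h : stoppedPath L (x 0) = ContinuousMap.const _ (L 0) := by
        ext1 t
        simp [stoppedPath, hx0]
      rw [h]
      exact .refl _
    | succ m ih =>
      obtain ⟨s, hs⟩ := hx m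
      exact (congrModCompact_stoppedPath (fun t => (hL t).1) hLρ ((hL s).1.add (hP s).2.1)
        ((hLρ s).add (hP s).2.2) (hAB s) (hBA s) (hP s) (hxmono m.le_succ)
        fun t ht => hs ht).trans ih
  have h : stoppedPath L (x n) = L := by
    ext1 t
    simp [stoppedPath, hn n le_rfl, min_eq_left (show t ≤ 1 from t.2.2)]
  have hkey := key n
  rwa [h] at hkey

/-- An equivariant indefinite selfadjoint Fredholm operator is congruent to an indefinite
equivariant symmetry, modulo a compact operator. -/
theorem exists_symmetry_of_mem_FSIndG {L : H →L[ℝ] H} (hL : L ∈ FSIndG ρ) :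
    ∃ Q : H →L[ℝ] H, IsSymmetry Q ∧ Q ∈ FSIndG ρ ∧
      ∃ M ∈ GLG ρ, ∃ K ∈ KSG ρ, star M * L * M = Q + K := by
  obtain ⟨⟨hLF, hLind⟩, hLρ⟩ := hL
  obtain ⟨P, hP, hPfin, hPu⟩ := exists_finiteRange_isUnit_add hLF hLρ
  obtain ⟨N, hNρ, hNu, Q, hQρ, hQ, hQQ, hNQ⟩ := exists_star_mul_involution_mul_eq
    (hLF.1.add hP.2.1) hPu (isEquivariant_iff_mem_centralizer.1 (hLρ.add hP.2.2))
  rw [← isEquivariant_iff_mem_centralizer] at hNρ hQρ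
  obtain ⟨M, hM, hMN, hNM⟩ := exists_inv_mem_GLG (ρ := ρ) ⟨hNu, hNρ⟩
  have hL' : L = star N * Q * N + -P := by rw [hNQ]; abel
  have hside : ∀ c : ℝ, c * c = 1 → -c ∉ essSpectrum Q → ∀ μ, c * μ ≤ 0 → μ ∉ essSpectrum L :=
    fun c hc hcQ μ hμ =>
      notMem_essSpectrum_of_congruent_involution hNu hPfin.neg hQQ hL' hc hcQ hμ
  have hQF : Q.IsFredholm := by
    simpa using (show IsUnit Q from ⟨⟨Q, Q, hQQ, hQQ⟩, rfl⟩).isFredholm_add (F := 0) (by simp)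
  refine ⟨Q, ⟨(2⁻¹ : ℝ) • (1 + Q), ⟨?_, ?_⟩, ?_⟩, ⟨⟨⟨hQ, hQF⟩, ?_⟩, hQρ⟩, M, hM,
    -(star M * P * M), ?_, ?_⟩
  · rw [IsIdempotentElem, smul_mul_smul_comm, mul_add, add_mul, add_mul, hQQ, one_mul, one_mul,
      mul_one]
    module
  · exact .smul (.all _) ((IsSelfAdjoint.one _).add hQ)
  · rw [← ContinuousLinearMap.one_def]
    module
  -- If `Q` were in `FSPlus`, then `-1` would miss its essential spectrum and `hside` would put `L`
  -- in `FSPlus`; symmetrically for `FSMinus`.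
  · rintro (h | h)
    · refine hLind (Or.inl ⟨hLF, fun μ hμ => ?_⟩)
      by_contra hneg
      refine hside 1 (by norm_num) (fun h1 => ?_) μ (by simpa using hneg) hμ
      have := h.2 h1
      norm_num at this
    · refine hLind (Or.inr ⟨hLF, fun μ hμ => ?_⟩)
      by_contra hneg
      refine hside (-1) (by norm_num) (fun h1 => ?_) μ (by simpa using hneg) hμ
      have := h.2 h1
      norm_num at this
  · have := sub_mem_KSG zero_mem_KSG (star_mul_mul_mem_KSG hP hM.2)
    rwa [zero_sub] at this
  · have h1 : star M * star N = 1 := by rw [← star_mul, hNM, star_one]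
    calc star M * L * M = (star M * star N) * Q * (N * M) + -(star M * P * M) := by
          rw [hL']; noncomm_ring
      _ = Q + -(star M * P * M) := by rw [h1, hNM, one_mul, mul_one]

end Paths

theorem theorem3p2
    {E : Type*} [NormedAddCommGroup E] [NormedSpace ℝ E] [FiniteDimensional ℝ E]
    {G : Type*} [Group G] [TopologicalSpace G] [ChartedSpace E G] [LieGroup 𝓘(ℝ, E) ∞ G]
    [T2Space G] [CompactSpace G]
    {H : Type*} [NormedAddCommGroup H] [InnerProductSpace ℝ H] [CompleteSpace H]
    [TopologicalSpace.SeparableSpace H] (_hH : ¬ FiniteDimensional ℝ H)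
    (ρ : G →* (H ≃ₗᵢ[ℝ] H))
    (L : C(unitInterval, FSIndG ρ)) :
    ∃ Q : H →L[ℝ] H, IsSymmetry Q ∧ Q ∈ FSIndG ρ ∧
      ∃ (M : C(unitInterval, GLG ρ)) (K : C(unitInterval, KSG ρ)),
        ∀ t : unitInterval,
          ContinuousLinearMap.adjoint (M t : H →L[ℝ] H) ∘L (L t : H →L[ℝ] H) ∘L
            (M t : H →L[ℝ] H) = Q + (K t : H →L[ℝ] H) := by
  obtain ⟨Q, hQ, hQ', M₀, hM₀, K₀, hK₀, h₀⟩ := exists_symmetry_of_mem_FSIndG (L 0).2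
  set L' : C(unitInterval, H →L[ℝ] H) := ⟨fun t => L t, by fun_prop⟩
  -- Only `L 0` is brought to normal form; constant paths `M₀`, `K₀` then link the constant path `L
  -- 0` to `Q`.
  have h := (congrModCompact_const (ρ := ρ) (L := L') (fun t => (L t).2.1.1)
    fun t => (L t).2.2).trans (L'' := ContinuousMap.const _ Q)
    ⟨ContinuousMap.const _ M₀, ContinuousMap.const _ K₀, fun _ => hM₀, fun _ => hK₀, fun _ => h₀⟩
  obtain ⟨M, K, hM, hK, h⟩ := h
  exact ⟨Q, hQ, hQ', ⟨fun t => ⟨M t, hM t⟩, by fun_prop⟩, ⟨fun t => ⟨K t, hK t⟩, by fun_prop⟩,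
    fun t => (mul_assoc _ _ _).symm.trans (h t)⟩
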